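/- Let $\mathcal V$ be an idempotent variety, i.e. one in which $f(x,\dots,x)\approx x$ holds for every basic operation $f$. Let $+$ be a compatible semilattice term of $\mathcal V$, i.e. a binary term such that on every $\mathbf A\in\mathcal V$ the operation $+$ is idempotent, commutative, associative, and a homomorphism $\mathbf A^2\to\mathbf A$. Let $\mathbf F=\mathbf F_{\mathcal V}(x,y)$ be the free algebra on $x,y$ in $\mathcal V$, let $R=\{t\in F : t+y=t\}$, and for $s,t\in R$ let $s\circ t=e_t(s)$, where $e_t$ is the endomorphism of $\mathbf F$ with $x\mapsto t$, $y\mapsto y$. Let $\mathbf R(\mathcal V)=(R;\circ,+,1,0)$ with $1=x+y$ and $0=y$; this is the semiring of $\mathcal V$. Then the map $$T\;\longmapsto\;\{(s,t)\in R\times R : \text{the identity } s(x,y)\approx t(x,y)\text{ belongs to } T\}$$ (where elements of $R$ are represented by binary terms; the choice of representatives does not matter) is an isomorphism from the lattice of equational theories $T$ that contain the equational theory of $\mathcal V$, ordered by inclusion, onto the congruence lattice $\operatorname{Con}(\mathbf R(\mathcal V))$. -/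

import Mathlib

universe u v

namespace UnivAlg

open FirstOrder FirstOrder.Language FirstOrder.Language.Structure

/-- An identity `t ≈ u` between terms in the variables `x₀, x₁, x₂, …`. -/
abbrev Identity (L : FirstOrder.Language.{u, v}) : Type u := L.Term ℕ × L.Term ℕ

/-- `A ⊨ t ≈ u`: both sides agree under every assignment of the variables. -/
def Satisfies {L : FirstOrder.Language.{u, v}} (A : Type u) [L.Structure A] (e : Identity L) : Prop :=
  ∀ w : ℕ → A, e.1.realize w = e.2.realize w

/-- A variety: a class of algebras that is defined by some set of identities. -/
structure Variety (L : FirstOrder.Language.{u, v}) where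
  Mem : ∀ (A : Type u) [L.Structure A], Prop
  equational : ∃ E : Set (Identity L), ∀ (A : Type u) [L.Structure A],
    Mem A ↔ ∀ e ∈ E, Satisfies A e

/-- An equational theory: the set of all identities that hold throughout some class of algebras. -/
structure EquationalTheory (L : FirstOrder.Language.{u, v}) where
  carrier : Set (Identity L)
  isTheory : ∃ K : ∀ A : Type u, L.Structure A → Prop, ∀ e : Identity L,
    e ∈ carrier ↔ ∀ (A : Type u) [S : L.Structure A], K A S → Satisfies A e

namespace EquationalTheory

variable {L : FirstOrder.Language.{u, v}}

theorem carrier_injective : Function.Injective (carrier (L := L)) := by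
  rintro ⟨S, hS⟩ ⟨T, hT⟩ h
  cases h
  rfl

/-- Equational theories are ordered by inclusion. -/
instance : PartialOrder (EquationalTheory L) :=
  PartialOrder.lift carrier carrier_injective

theorem le_def {S T : EquationalTheory L} : S ≤ T ↔ S.carrier ⊆ T.carrier := Iff.rfl

/-- The meet of a family of equational theories is its intersection. -/
instance : InfSet (EquationalTheory L) where
  sInf 𝒯 :=
    { carrier := {e | ∀ T ∈ 𝒯, e ∈ T.carrier}
      isTheory := by
        refine ⟨fun A S => ∃ T ∈ 𝒯, ∀ e ∈ T.carrier, @Satisfies L A S e, fun e => ⟨?_, ?_⟩⟩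
        · rintro h A S ⟨T, hT, hA⟩
          exact hA e (h T hT)
        · intro h T hT
          obtain ⟨K, hK⟩ := T.isTheory
          exact (hK e).2 fun A S hA => h A ⟨T, hT, fun e' he' => (hK e').1 he' A hA⟩ }

instance : CompleteLattice (EquationalTheory L) :=
  completeLatticeOfInf _ fun _ =>
    ⟨fun _ hT _ he => he _ hT, fun _ hS _ he T hT => hS hT he⟩

end EquationalTheory

namespace Variety

variable {L : FirstOrder.Language.{u, v}} (V : Variety L)

/-- The equational theory of `V`. -/
def eqTheory : EquationalTheory L where
  carrier := {e | ∀ (A : Type u) [L.Structure A], V.Mem A → Satisfies A e}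
  isTheory := ⟨fun A S => @Mem L V A S, fun _ => Iff.rfl⟩

/-- `V` is idempotent: `f(x, …, x) = x` for every basic operation `f`
(for a constant symbol `c` this reads `c = x`). -/
def IsIdempotent : Prop :=
  ∀ (A : Type u) [L.Structure A], V.Mem A →
    ∀ (n : ℕ) (f : L.Functions n) (a : A), funMap f (fun _ : Fin n => a) = a

/-- The binary term `p` is a compatible semilattice term of `V`: on each `A ∈ V` the operation
`p(a, b)` is idempotent, commutative, associative, and a homomorphism `A² → A`. -/
structure IsCompatibleSemilatticeTerm (p : L.Term (Fin 2)) : Prop where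
  idem : ∀ (A : Type u) [L.Structure A], V.Mem A → ∀ a : A, p.realize ![a, a] = a
  comm : ∀ (A : Type u) [L.Structure A], V.Mem A →
    ∀ a b : A, p.realize ![a, b] = p.realize ![b, a]
  assoc : ∀ (A : Type u) [L.Structure A], V.Mem A → ∀ a b c : A,
    p.realize ![p.realize ![a, b], c] = p.realize ![a, p.realize ![b, c] ]
  compat : ∀ (A : Type u) [L.Structure A], V.Mem A →
    ∀ (n : ℕ) (f : L.Functions n) (a b : Fin n → A),
      p.realize ![funMap f a, funMap f b] = funMap f fun i => p.realize ![a i, b i]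

/-- Two terms are identified when they induce the same operation on every member of `V`. -/
def termSetoid (X : Type) : Setoid (L.Term X) where
  r s t := ∀ (A : Type u) [L.Structure A], V.Mem A → ∀ w : X → A, s.realize w = t.realize w
  iseqv :=
    ⟨fun _ _ _ _ _ => rfl, fun h A _ hA w => (h A hA w).symm,
      fun h h' A _ hA w => (h A hA w).trans (h' A hA w)⟩

/-- The free algebra `F_V(X)`: terms over `X` modulo the identities of `V`. -/
def Free (X : Type) : Type u := Quotient (V.termSetoid X)

/-- The element of `F_V(X)` represented by a term. -/
def ofTerm {X : Type} (t : L.Term X) : V.Free X := Quotient.mk (V.termSetoid X) t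

variable [L.IsAlgebraic]

/-- The algebra of terms; the basic operations are formal application. -/
instance termPrestructure (X : Type) : L.Prestructure (V.termSetoid X) where
  toStructure :=
    { funMap := fun f ts => Term.func f ts
      RelMap := fun {n} r _ => isEmptyElim r }
  fun_equiv {_ f} _ _ h A _ hA w := congrArg (funMap f) (funext fun i => h i A hA w)
  rel_equiv {_ r} := isEmptyElim r

instance freeStructure (X : Type) : L.Structure (V.Free X) :=
  inferInstanceAs (L.Structure (Quotient (V.termSetoid X)))

theorem funMap_ofTerm {X : Type} {n : ℕ} (f : L.Functions n) (ts : Fin n → L.Term X) :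
    funMap f (fun i => V.ofTerm (ts i)) = V.ofTerm (Term.func f ts) :=
  funMap_quotient_mk' (V.termSetoid X) f ts

theorem realize_ofTerm {X Y : Type} (t : L.Term Y) (g : Y → L.Term X) :
    t.realize (fun i => V.ofTerm (g i)) = V.ofTerm (t.subst g) := by
  induction t with
  | var => rfl
  | func f ts ih => simp only [Term.realize_func, ih, funMap_ofTerm, Term.subst]

theorem ofTerm_surjective (X : Type) : Function.Surjective (V.ofTerm (X := X)) :=
  Quotient.exists_rep

/-- `F_V(X)` belongs to `V`. -/
theorem mem_free (X : Type) : V.Mem (V.Free X) := by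
  obtain ⟨E, hE⟩ := V.equational
  refine (hE _).2 fun e he w => ?_
  choose g hg using fun i => V.ofTerm_surjective X (w i)
  obtain rfl : (fun i => V.ofTerm (g i)) = w := funext hg
  rw [realize_ofTerm, realize_ofTerm]
  refine Quotient.sound (s := V.termSetoid X) fun A _ hA w => ?_
  rw [Term.realize_subst, Term.realize_subst]
  exact (hE A).1 hA e he _

/-- The universal property of `F_V(X)`: a map from `X` to `A ∈ V` extends to a homomorphism. -/
def lift {X : Type} {A : Type u} [L.Structure A] (hA : V.Mem A) (g : X → A) : V.Free X →[L] A where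
  toFun := Quotient.lift (fun t : L.Term X => t.realize g) fun _ _ h => h A hA g
  map_fun' {n} f x := by
    choose ts hts using fun i => V.ofTerm_surjective X (x i)
    obtain rfl : (fun i => V.ofTerm (ts i)) = x := funext hts
    rw [funMap_ofTerm]
    rfl
  map_rel' r := isEmptyElim r

theorem lift_ofTerm {X : Type} {A : Type u} [L.Structure A] (hA : V.Mem A) (g : X → A)
    (t : L.Term X) : V.lift hA g (V.ofTerm t) = t.realize g := rfl

/-- The generator `x` of `F_V(x, y)`. -/
def genX : V.Free (Fin 2) := V.ofTerm (Term.var 0)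

/-- The generator `y` of `F_V(x, y)`. -/
def genY : V.Free (Fin 2) := V.ofTerm (Term.var 1)

/-- The endomorphism `e_t` of `F_V(x, y)` with `x ↦ t` and `y ↦ y`. -/
def endo (t : V.Free (Fin 2)) : V.Free (Fin 2) →[L] V.Free (Fin 2) :=
  V.lift (V.mem_free (Fin 2)) ![t, V.genY]

theorem endo_y (t : V.Free (Fin 2)) : V.endo t V.genY = V.genY := rfl

theorem endo_realize (t : V.Free (Fin 2)) (p : L.Term (Fin 2)) (a b : V.Free (Fin 2)) :
    V.endo t (p.realize ![a, b]) = p.realize ![V.endo t a, V.endo t b] := by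
  rw [← HomClass.realize_term]
  congr 1
  funext i
  fin_cases i <;> rfl

variable (p : L.Term (Fin 2)) (hV : V.IsIdempotent) (hp : V.IsCompatibleSemilatticeTerm p)

/-- The subuniverse `R = {t | t + y = t}` of `F_V(x, y)`, where `a + b = p(a, b)`;
it is the universe of the semiring `R(V)`. -/
def semiring : L.Substructure (V.Free (Fin 2)) where
  carrier := {t | p.realize ![t, V.genY] = t}
  fun_mem {n} f a ha := by
    have hF := V.mem_free (Fin 2)
    have h := hp.compat _ hF n f a fun _ => V.genY
    rw [hV _ hF n f V.genY] at h
    exact h.trans (congrArg (funMap f) (funext ha))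

theorem mem_semiring {t : V.Free (Fin 2)} :
    t ∈ V.semiring p hV hp ↔ p.realize ![t, V.genY] = t := Iff.rfl

/-- Addition in `R(V)` is the semilattice operation. -/
instance : Add (V.semiring p hV hp) where
  add s t := ⟨p.realize ![s.1, t.1], by
    rw [mem_semiring, hp.assoc _ (V.mem_free _), (V.mem_semiring p hV hp).1 t.2]⟩

/-- Multiplication in `R(V)` is `s ∘ t = e_t(s)`. -/
instance : Mul (V.semiring p hV hp) where
  mul s t := ⟨V.endo t.1 s.1, by
    have h := V.endo_realize t.1 p s.1 V.genY
    rw [(V.mem_semiring p hV hp).1 s.2, endo_y] at h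
    exact h.symm⟩

/-- The zero of `R(V)` is `y`. -/
instance : Zero (V.semiring p hV hp) where
  zero := ⟨V.genY, hp.idem _ (V.mem_free _) V.genY⟩

/-- The one of `R(V)` is `x + y`. -/
instance : One (V.semiring p hV hp) where
  one := ⟨p.realize ![V.genX, V.genY], by
    rw [mem_semiring, hp.assoc _ (V.mem_free _), hp.idem _ (V.mem_free _)]⟩

end Variety

/-- A binary term in `x, y` read as a term in the variables `x₀, x₁`. -/
def binaryTerm {L : FirstOrder.Language.{u, v}} (t : L.Term (Fin 2)) : L.Term ℕ :=
  t.relabel fun i : Fin 2 => (i : ℕ)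

end UnivAlg

namespace UnivAlg

open FirstOrder FirstOrder.Language FirstOrder.Language.Structure

/-! Every term s commutes with + and satisfies s(y,…,y) = y. So on elements with w_i + y = w_i it is
additive: s(w) is the sum of the s_j(w_j, y), where s_j = s(y,…,x+y,…,y) lies in R
(`realize_truncate_succ`). The restriction on w is harmless, since s(w) = t(w) as soon as s(w) + y =
t(w) + y for all y. Hence within V an identity is equivalent to binary identities between elements
of R (`satisfies_iff_coeff`), and the map is an order embedding.

For surjectivity, R is a subalgebra of F on which terms act as linear forms over R, so a semiring
congruence θ is a congruence of this algebra (`realize_congr`), and R/θ is in V. An element t of R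
acts as t∘a + b (`realize_eq_mul_add`), and evaluation at (1, 0) recovers t. So s ≈ t holds in R/θ
iff θ relates s and t: the theory of R/θ is a preimage of θ. -/

theorem realize_binaryTerm {L : FirstOrder.Language.{u, v}} {A : Type u} [L.Structure A]
    (t : L.Term (Fin 2)) (w : ℕ → A) : (binaryTerm t).realize w = t.realize ![w 0, w 1] := by
  rw [binaryTerm, Term.realize_relabel]
  congr 1
  funext i
  fin_cases i <;> rfl

theorem satisfies_binaryTerm {L : FirstOrder.Language.{u, v}} {A : Type u} [L.Structure A]
    (s t : L.Term (Fin 2)) :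
    Satisfies A (binaryTerm s, binaryTerm t) ↔
      ∀ a b : A, s.realize ![a, b] = t.realize ![a, b] := by
  constructor
  · intro h a b
    simpa only [realize_binaryTerm, if_true, one_ne_zero, if_false] using
      h fun i => if i = 0 then a else b
  · intro h w
    simp only [realize_binaryTerm]
    exact h _ _

/-- The equational theory of a single algebra. -/
def theoryOf {L : FirstOrder.Language.{u, v}} (A : Type u) [L.Structure A] :
    EquationalTheory L where
  carrier := {e | Satisfies A e}
  isTheory := ⟨fun B S => ∀ e, Satisfies A e → @Satisfies L B S e, fun e =>
    ⟨fun he _ _ hB => hB e he, fun h => h A fun _ he => he⟩⟩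

/-- Closure under semantic consequence: it allows arguing in the models of `T` instead of the
defining class. -/
theorem EquationalTheory.mem_iff {L : FirstOrder.Language.{u, v}} (T : EquationalTheory L)
    (e : Identity L) :
    e ∈ T.carrier ↔
      ∀ (A : Type u) [L.Structure A], (∀ e' ∈ T.carrier, Satisfies A e') → Satisfies A e := by
  refine ⟨fun he A _ hA => hA e he, fun h => ?_⟩
  obtain ⟨K, hK⟩ := T.isTheory
  exact (hK e).2 fun A S hA => h A fun e' he' => (hK e').1 he' A hA

namespace Variety

variable {L : FirstOrder.Language.{u, v}} (V : Variety L)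

theorem mem_iff_satisfies_eqTheory (A : Type u) [L.Structure A] :
    V.Mem A ↔ ∀ e ∈ V.eqTheory.carrier, Satisfies A e := by
  refine ⟨fun hA e he => he A hA, fun h => ?_⟩
  obtain ⟨E, hE⟩ := V.equational
  exact (hE A).2 fun e he => h e fun B _ hB => (hE B).1 hB e he

variable {V}

theorem IsIdempotent.realize_const (hV : V.IsIdempotent) {A : Type u} [L.Structure A]
    (hA : V.Mem A) {X : Type} (t : L.Term X) (a : A) : t.realize (fun _ => a) = a := by
  induction t with
  | var => rfl
  | func f ts ih =>
    rw [Term.realize_func, funext ih]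
    exact hV A hA _ f a

theorem IsIdempotent.realize_pair (hV : V.IsIdempotent) {A : Type u} [L.Structure A]
    (hA : V.Mem A) (t : L.Term (Fin 2)) (a : A) : t.realize ![a, a] = a := by
  rw [← hV.realize_const hA t a]
  congr 1
  funext i
  fin_cases i <;> simp [hV.realize_const hA]

variable {p : L.Term (Fin 2)}

theorem IsCompatibleSemilatticeTerm.realize (hp : V.IsCompatibleSemilatticeTerm p)
    {A : Type u} [L.Structure A] (hA : V.Mem A) {X : Type} (t : L.Term X) (a b : X → A) :
    p.realize ![t.realize a, t.realize b] = t.realize fun i => p.realize ![a i, b i] := by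
  induction t with
  | var => rfl
  | func f ts ih =>
    simp only [Term.realize_func]
    rw [hp.compat A hA, funext ih]

theorem IsCompatibleSemilatticeTerm.realize_pair (hp : V.IsCompatibleSemilatticeTerm p)
    {A : Type u} [L.Structure A] (hA : V.Mem A) (t : L.Term (Fin 2)) (a b c d : A) :
    p.realize ![t.realize ![a, b], t.realize ![c, d] ] =
      t.realize ![p.realize ![a, c], p.realize ![b, d] ] := by
  rw [hp.realize hA]
  congr 1
  funext i
  fin_cases i <;> rfl

/-! ### Coefficients of a term -/

/-- The `j`-th coefficient of `s`: substitute `x + y` for the `j`-th variable and `y` for the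
others. -/
def coeff (p : L.Term (Fin 2)) (j : ℕ) (s : L.Term ℕ) : L.Term (Fin 2) :=
  s.subst fun i => if i = j then p else Term.var 1

theorem realize_coeff {A : Type u} [L.Structure A] (j : ℕ) (s : L.Term ℕ) (a b : A) :
    (coeff p j s).realize ![a, b] =
      s.realize fun i => if i = j then p.realize ![a, b] else b := by
  rw [coeff, Term.realize_subst]
  congr 1
  funext i
  split_ifs <;> rfl

/-- A term only depends on finitely many variables. -/
theorem exists_realize_truncate (s : L.Term ℕ) :
    ∃ n, ∀ m ≥ n, ∀ (A : Type u) [L.Structure A] (w : ℕ → A) (y : A),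
      (s.realize fun i => if i < m then w i else y) = s.realize w := by
  induction s with
  | var i => exact ⟨i + 1, fun m hm A _ w y => if_pos (by omega)⟩
  | func f ts ih =>
    choose N hN using ih
    refine ⟨Finset.univ.sup N, fun m hm A _ w y => ?_⟩
    simp only [Term.realize_func]
    congr 1
    funext i
    exact hN i m ((Finset.le_sup (Finset.mem_univ i)).trans hm) A w y

theorem realize_truncate_succ (hp : V.IsCompatibleSemilatticeTerm p)
    {A : Type u} [L.Structure A] (hA : V.Mem A) (s : L.Term ℕ) (w : ℕ → A) (y : A)
    (hw : ∀ i, p.realize ![w i, y] = w i) (n : ℕ) :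
    (s.realize fun i => if i < n + 1 then w i else y) =
      p.realize ![s.realize fun i => if i < n then w i else y,
        (coeff p n s).realize ![w n, y] ] := by
  rw [realize_coeff, hp.realize hA]
  congr 1
  funext i
  -- Coordinatewise: w_i + y = w_i below n, y + (w_n + y) = w_n at n, and y + y = y above n.
  rcases lt_trichotomy i n with hi | rfl | hi
  · simp [hi, hi.ne, hi.trans n.lt_succ_self, hw]
  · simp [hw, hp.comm A hA y]
  · simp [hi.not_gt, hi.ne', not_lt.2 (Nat.succ_le_of_lt hi), hp.idem A hA]

/-- Above `y`, a term is determined by its coefficients. -/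
theorem realize_eq_of_coeff (hV : V.IsIdempotent) (hp : V.IsCompatibleSemilatticeTerm p)
    {A : Type u} [L.Structure A] (hA : V.Mem A) (s t : L.Term ℕ)
    (h : ∀ j (a b : A), (coeff p j s).realize ![a, b] = (coeff p j t).realize ![a, b])
    (w : ℕ → A) (y : A) (hw : ∀ i, p.realize ![w i, y] = w i) : s.realize w = t.realize w := by
  have trunc : ∀ n, (s.realize fun i => if i < n then w i else y) =
      t.realize fun i => if i < n then w i else y := by
    intro n
    induction n with
    | zero => simp [hV.realize_const hA]
    | succ n ih => rw [realize_truncate_succ hp hA s w y hw, realize_truncate_succ hp hA t w y hw,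
        ih, h]
  obtain ⟨m, hm⟩ := exists_realize_truncate s
  obtain ⟨n, hn⟩ := exists_realize_truncate t
  rw [← hm (max m n) (le_max_left _ _) A w y, trunc, hn (max m n) (le_max_right _ _) A w y]

/-- An identity holds in a member of `V` iff the identities between the coefficients do. -/
theorem satisfies_iff_coeff (hV : V.IsIdempotent) (hp : V.IsCompatibleSemilatticeTerm p)
    {A : Type u} [L.Structure A] (hA : V.Mem A) (s t : L.Term ℕ) :
    Satisfies A (s, t) ↔
      ∀ j, Satisfies A (binaryTerm (coeff p j s), binaryTerm (coeff p j t)) := by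
  simp only [satisfies_binaryTerm]
  constructor
  · intro h j a b
    rw [realize_coeff, realize_coeff]
    exact h _
  · intro h w
    -- Writing y as s(y,…,y) gives s(w) + y = s(w + y), and the entries w_i + y lie above y.
    have key : ∀ y, p.realize ![s.realize w, y] = p.realize ![t.realize w, y] := by
      intro y
      rw [← hV.realize_const hA s y, hp.realize hA, hV.realize_const hA s y,
        ← hV.realize_const hA t y, hp.realize hA, hV.realize_const hA t y]
      exact realize_eq_of_coeff hV hp hA s t h _ y fun i => by
        rw [hp.assoc A hA, hp.idem A hA]
    -- `key` is used at y = s(w) and at y = t(w).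
    calc s.realize w = p.realize ![s.realize w, s.realize w] := (hp.idem A hA _).symm
      _ = p.realize ![s.realize w, t.realize w] := by rw [key, hp.comm A hA]
      _ = t.realize w := by rw [key, hp.idem A hA]

/-! ### From theories to congruences -/

variable [L.IsAlgebraic]

theorem ofTerm_eq_realize (t : L.Term (Fin 2)) :
    V.ofTerm t = t.realize ![V.genX, V.genY] := by
  have h := V.realize_ofTerm t (fun i => Term.var i)
  have hid : t.subst (fun i => Term.var i) = t := by
    induction t with
    | var => rfl
    | func f ts ih =>
      rw [Term.subst]
      congr 1
      funext i
      exact ih i (V.realize_ofTerm _ _)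
  rw [hid] at h
  rw [← h]
  congr 1
  funext i
  fin_cases i <;> rfl

variable (hV : V.IsIdempotent) (hp : V.IsCompatibleSemilatticeTerm p)

theorem ofTerm_coeff_mem (j : ℕ) (s : L.Term ℕ) :
    V.ofTerm (coeff p j s) ∈ V.semiring p hV hp := by
  have hF := V.mem_free (Fin 2)
  rw [mem_semiring, ofTerm_eq_realize, realize_coeff]
  refine (congrArg (fun z => p.realize ![_, z]) (hV.realize_const hF s V.genY).symm).trans ?_
  rw [hp.realize hF]
  congr 1
  funext i
  split_ifs
  · rw [hp.assoc _ hF, hp.idem _ hF]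
  · rw [hp.idem _ hF]

/-- The congruence of the semiring given by the identities in `T`. -/
def congruenceOf (T : EquationalTheory L) : RingCon (V.semiring p hV hp) where
  r a b := ∀ (A : Type u) [L.Structure A] (hA : V.Mem A),
    (∀ e ∈ T.carrier, Satisfies A e) → ∀ w, V.lift hA w a.1 = V.lift hA w b.1
  iseqv :=
    ⟨fun _ _ _ _ _ _ => rfl, fun h A _ hA hT w => (h A hA hT w).symm,
      fun h h' A _ hA hT w => (h A hA hT w).trans (h' A hA hT w)⟩
  add' {a b c d} hab hcd A _ hA hT w := by
    have hom : ∀ r s : V.semiring p hV hp, V.lift hA w (r + s).1 =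
        p.realize ![V.lift hA w r.1, V.lift hA w s.1] := by
      intro r s
      refine (HomClass.realize_term (V.lift hA w) (t := p) (v := ![r.1, s.1])).symm.trans ?_
      congr 1
      funext i
      fin_cases i <;> rfl
    rw [hom, hom, hab A hA hT, hcd A hA hT]
  mul' {a b c d} hab hcd A _ hA hT w := by
    -- Evaluating r∘s at (a, b) is evaluating r at (s(a, b), b).
    have hom : ∀ r s : V.semiring p hV hp, V.lift hA w (r * s).1 =
        V.lift hA ![V.lift hA w s.1, w 1] r.1 := by
      rintro ⟨r, hr⟩ s
      obtain ⟨r, rfl⟩ := V.ofTerm_surjective _ r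
      refine (HomClass.realize_term (V.lift hA w) (t := r) (v := ![s.1, V.genY])).symm.trans ?_
      rw [lift_ofTerm]
      congr 1
      funext i
      fin_cases i <;> rfl
    rw [hom, hom, hcd A hA hT, hab A hA hT]

theorem congruenceOf_iff {T : EquationalTheory L} (hT : V.eqTheory ≤ T) (s t : L.Term (Fin 2))
    (hs : V.ofTerm s ∈ V.semiring p hV hp) (ht : V.ofTerm t ∈ V.semiring p hV hp) :
    congruenceOf hV hp T ⟨V.ofTerm s, hs⟩ ⟨V.ofTerm t, ht⟩ ↔
      (binaryTerm s, binaryTerm t) ∈ T.carrier := by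
  rw [T.mem_iff]
  constructor
  · intro h A _ hA
    rw [satisfies_binaryTerm]
    exact fun a b => h A ((V.mem_iff_satisfies_eqTheory A).2 fun e he => hA e (hT he)) hA ![a, b]
  · intro h A _ hAV hA w
    have hw : w = ![w 0, w 1] := by
      funext i
      fin_cases i <;> rfl
    show s.realize w = t.realize w
    rw [hw]
    exact (satisfies_binaryTerm s t).1 (h A hA) _ _

theorem congruenceOf_le_iff {S T : EquationalTheory L} (hS : V.eqTheory ≤ S)
    (hT : V.eqTheory ≤ T) : congruenceOf hV hp S ≤ congruenceOf hV hp T ↔ S ≤ T := by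
  constructor
  · rintro h ⟨s, t⟩ hst
    refine (T.mem_iff _).2 fun A _ hA => ?_
    have hAV : V.Mem A := (V.mem_iff_satisfies_eqTheory A).2 fun e he => hA e (hT he)
    refine (satisfies_iff_coeff hV hp hAV s t).2 fun j => hA _ ?_
    have hs := ofTerm_coeff_mem hV hp j s
    have ht := ofTerm_coeff_mem hV hp j t
    refine (congruenceOf_iff hV hp hT _ _ hs ht).1 (h ?_)
    refine (congruenceOf_iff hV hp hS _ _ hs ht).2 ((S.mem_iff _).2 fun B _ hB => ?_)
    have hBV : V.Mem B := (V.mem_iff_satisfies_eqTheory B).2 fun e he => hB e (hS he)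
    exact (satisfies_iff_coeff hV hp hBV s t).1 (hB _ hst) j
  · intro h a b hab A _ hA hT' w
    exact hab A hA (fun e he => hT' e (h he)) w

/-! ### R as an algebra of V -/

theorem realize_mem_semiring {X : Type} (t : L.Term X) (w : X → V.semiring p hV hp) :
    (t.realize w).1 = t.realize fun i => (w i).1 :=
  (HomClass.realize_term (V.semiring p hV hp).subtype (t := t) (v := w)).symm

theorem mem_of_satisfies {A : Type u} [L.Structure A]
    (h : ∀ e : Identity L, Satisfies (V.Free (Fin 2)) e → Satisfies A e) : V.Mem A :=
  (V.mem_iff_satisfies_eqTheory A).2 fun e he => h e (he _ (V.mem_free _))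

theorem mem_substructure : V.Mem (V.semiring p hV hp) :=
  mem_of_satisfies fun e he w => Subtype.ext <| by
    rw [realize_mem_semiring, realize_mem_semiring]
    exact he _

theorem realize_semiring_pair (t : L.Term (Fin 2)) (a b : V.semiring p hV hp) :
    (t.realize ![a, b]).1 = t.realize ![a.1, b.1] := by
  rw [realize_mem_semiring]
  congr 1
  funext i
  fin_cases i <;> rfl

theorem add_eq_realize (a b : V.semiring p hV hp) : a + b = p.realize ![a, b] :=
  Subtype.ext (realize_semiring_pair hV hp p a b).symm

theorem add_zero_eq (a : V.semiring p hV hp) : a + 0 = a := Subtype.ext a.2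

theorem zero_add_eq (a : V.semiring p hV hp) : 0 + a = a := by
  have h := add_zero_eq hV hp a
  rw [add_eq_realize, hp.comm _ (mem_substructure hV hp)] at h
  rwa [add_eq_realize]

theorem mul_eq_realize (t : L.Term (Fin 2)) (ht : V.ofTerm t ∈ V.semiring p hV hp)
    (a : V.semiring p hV hp) : ⟨V.ofTerm t, ht⟩ * a = t.realize ![a, 0] :=
  Subtype.ext (realize_semiring_pair hV hp t a 0).symm

/-- a(x+y, y) = a(x, y) + a(y, y) = a + y = a. -/
theorem mul_one_eq (a : V.semiring p hV hp) : a * 1 = a := by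
  obtain ⟨a, ha⟩ := a
  obtain ⟨t, rfl⟩ := V.ofTerm_surjective _ a
  have hF := V.mem_free (Fin 2)
  refine Subtype.ext (Eq.trans ?_ ha)
  show t.realize ![p.realize ![V.genX, V.genY], V.genY] = _
  rw [ofTerm_eq_realize]
  conv_rhs => rw [← hV.realize_pair hF t V.genY, hp.realize_pair hF, hV.realize_pair hF t,
    hp.idem _ hF]

/-- On the semiring, a term operation from the semiring is `(a, b) ↦ t ∘ a + b`. -/
theorem realize_eq_mul_add (t : L.Term (Fin 2)) (ht : V.ofTerm t ∈ V.semiring p hV hp)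
    (a b : V.semiring p hV hp) : t.realize ![a, b] = ⟨V.ofTerm t, ht⟩ * a + b := by
  have hR := mem_substructure hV hp
  -- The equation t + y = t in F is transported along x ↦ c, y ↦ d.
  have absorb : ∀ c d : V.semiring p hV hp,
      p.realize ![t.realize ![c, d], d] = t.realize ![c, d] := by
    intro c d
    refine Subtype.ext ?_
    rw [realize_semiring_pair, realize_semiring_pair]
    have h := congrArg (V.lift (V.mem_free (Fin 2)) ![c.1, d.1]) ht
    rw [← HomClass.realize_term] at h
    refine Eq.trans ?_ h
    congr 1
    funext i
    fin_cases i <;> rfl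
  -- t(0, b) = t(0, b) + b = t(0, b) + t(b, b) = t(0 + b, b + b) = b.
  have hb : t.realize ![0, b] = b := by
    have h := hp.realize_pair hR t 0 b b b
    rwa [hV.realize_pair hR, absorb, ← add_eq_realize, zero_add_eq, hp.idem _ hR,
      hV.realize_pair hR] at h
  rw [mul_eq_realize, add_eq_realize]
  -- t(a, 0) + t(0, b) = t(a + 0, 0 + b).
  conv_rhs => rw [← hb, hp.realize_pair hR]
  rw [← add_eq_realize, ← add_eq_realize, zero_add_eq, add_zero_eq]

/-! ### From congruences to theories -/

variable {hV hp} (θ : RingCon (V.semiring p hV hp))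

/-- A semiring congruence is compatible with all term operations. -/
theorem realize_congr (s : L.Term ℕ) (a b : ℕ → V.semiring p hV hp) (h : ∀ i, θ (a i) (b i)) :
    θ (s.realize a) (s.realize b) := by
  have hR := mem_substructure hV hp
  have hzero : ∀ c : V.semiring p hV hp, p.realize ![c, 0] = c := fun c =>
    (add_eq_realize hV hp c 0).symm.trans (add_zero_eq hV hp c)
  have trunc : ∀ n, θ (s.realize fun i => if i < n then a i else 0)
      (s.realize fun i => if i < n then b i else 0) := by
    intro n
    induction n with
    | zero => simpa using θ.refl _
    | succ n ih =>
      -- With y = 0 every element of R is above y, and each summand is a coefficient times a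
      -- variable.
      rw [realize_truncate_succ hp hR s a 0 fun _ => hzero _,
        realize_truncate_succ hp hR s b 0 fun _ => hzero _, ← add_eq_realize, ← add_eq_realize,
        ← mul_eq_realize hV hp _ (ofTerm_coeff_mem hV hp n s),
        ← mul_eq_realize hV hp _ (ofTerm_coeff_mem hV hp n s)]
      exact θ.add ih (θ.mul (θ.refl _) (h n))
  obtain ⟨n, hn⟩ := exists_realize_truncate s
  rw [← hn n le_rfl _ a 0, ← hn n le_rfl _ b 0]
  exact trunc n

theorem funMap_congr {n : ℕ} (f : L.Functions n) (a b : Fin n → V.semiring p hV hp)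
    (h : ∀ i, θ (a i) (b i)) : θ (funMap f a) (funMap f b) := by
  -- Padding by 0 turns `f` into a term in variables indexed by ℕ.
  have extend : ∀ c : Fin n → V.semiring p hV hp, funMap f c =
      (Term.func f fun i : Fin n => Term.var (i : ℕ)).realize
        fun i => if hi : i < n then c ⟨i, hi⟩ else 0 := by
    intro c
    simp [Term.realize_func]
  rw [extend a, extend b]
  refine realize_congr θ _ _ _ fun i => ?_
  split_ifs
  · exact h _
  · exact θ.refl _

/-- The quotient algebra of the semiring by a semiring congruence. -/
def QuotientAlgebra : Type u := Quotient θ.toSetoid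

instance congruencePrestructure : L.Prestructure θ.toSetoid where
  toStructure := inferInstance
  fun_equiv {_ f} a b h := funMap_congr θ f a b h
  rel_equiv {_ r} := isEmptyElim r

instance quotientAlgebraStructure : L.Structure (QuotientAlgebra θ) :=
  inferInstanceAs (L.Structure (Quotient θ.toSetoid))

/-- The class of an element of the semiring. -/
def toQuotient (a : V.semiring p hV hp) : QuotientAlgebra θ := Quotient.mk θ.toSetoid a

theorem toQuotient_eq_iff (a b : V.semiring p hV hp) :
    toQuotient θ a = toQuotient θ b ↔ θ a b := Quotient.eq (r := θ.toSetoid)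

theorem toQuotient_surjective : Function.Surjective (toQuotient θ) := Quotient.exists_rep

theorem realize_toQuotient {X : Type} (t : L.Term X) (w : X → V.semiring p hV hp) :
    (t.realize fun i => toQuotient θ (w i)) = toQuotient θ (t.realize w) := by
  induction t with
  | var => rfl
  | func f ts ih =>
    simp only [Term.realize_func, ih]
    exact funMap_quotient_mk' θ.toSetoid f _

theorem mem_quotientAlgebra : V.Mem (QuotientAlgebra θ) :=
  (V.mem_iff_satisfies_eqTheory _).2 fun e he w => by
    choose g hg using fun i => toQuotient_surjective θ (w i)
    obtain rfl : (fun i => toQuotient θ (g i)) = w := funext hg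
    rw [realize_toQuotient, realize_toQuotient, he _ (mem_substructure hV hp)]

/-- The quotient by `θ` satisfies an identity between elements of the semiring iff `θ` relates
them. -/
theorem satisfies_quotientAlgebra_iff (s t : L.Term (Fin 2))
    (hs : V.ofTerm s ∈ V.semiring p hV hp) (ht : V.ofTerm t ∈ V.semiring p hV hp) :
    Satisfies (QuotientAlgebra θ) (binaryTerm s, binaryTerm t) ↔
      θ ⟨V.ofTerm s, hs⟩ ⟨V.ofTerm t, ht⟩ := by
  have pair : ∀ (r : L.Term (Fin 2)) (hr : V.ofTerm r ∈ V.semiring p hV hp)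
      (a b : V.semiring p hV hp), r.realize ![toQuotient θ a, toQuotient θ b] =
        toQuotient θ (⟨V.ofTerm r, hr⟩ * a + b) := by
    intro r hr a b
    rw [← realize_eq_mul_add, ← realize_toQuotient]
    congr 1
    funext i
    fin_cases i <;> rfl
  rw [satisfies_binaryTerm]
  constructor
  · intro h
    -- At (1, 0) the operation of s takes the value s∘1 + 0 = s.
    have h10 := h (toQuotient θ 1) (toQuotient θ 0)
    rwa [pair s hs, pair t ht, toQuotient_eq_iff, mul_one_eq, mul_one_eq, add_zero_eq,
      add_zero_eq] at h10
  · intro h a b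
    obtain ⟨a, rfl⟩ := toQuotient_surjective θ a
    obtain ⟨b, rfl⟩ := toQuotient_surjective θ b
    rw [pair s hs, pair t ht, toQuotient_eq_iff]
    exact θ.add (θ.mul h (θ.refl a)) (θ.refl b)

theorem eqTheory_le_theoryOf : V.eqTheory ≤ theoryOf (QuotientAlgebra θ) :=
  fun _ he => he _ (mem_quotientAlgebra θ)

theorem congruenceOf_theoryOf : congruenceOf hV hp (theoryOf (QuotientAlgebra θ)) = θ := by
  refine RingCon.ext fun a b => ?_
  obtain ⟨a, ha⟩ := a
  obtain ⟨b, hb⟩ := b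
  obtain ⟨s, rfl⟩ := V.ofTerm_surjective _ a
  obtain ⟨t, rfl⟩ := V.ofTerm_surjective _ b
  exact (congruenceOf_iff hV hp (eqTheory_le_theoryOf θ) s t ha hb).trans
    (satisfies_quotientAlgebra_iff θ s t ha hb)

variable (hV hp) in
/-- Theories extending that of `V` correspond to congruences of the semiring. -/
noncomputable def theoryIso : Set.Ici V.eqTheory ≃o RingCon (V.semiring p hV hp) :=
  RelIso.ofSurjective
    (OrderEmbedding.ofMapLEIff (fun T : Set.Ici V.eqTheory => congruenceOf hV hp T.1)
      fun S T => congruenceOf_le_iff hV hp S.2 T.2)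
    fun θ => ⟨⟨theoryOf (QuotientAlgebra θ), eqTheory_le_theoryOf θ⟩, congruenceOf_theoryOf θ⟩

end Variety

end UnivAlg

/-- The isomorphism is the natural one: a theory `T` extending that of `V` corresponds to the
congruence relating the elements of `R(V)` represented by binary terms `s`, `t` iff `s ≈ t` is in
`T`. -/
theorem theorem6p4 {L : FirstOrder.Language.{u, v}} [L.IsAlgebraic] (V : UnivAlg.Variety L)
    (hV : V.IsIdempotent) (p : L.Term (Fin 2)) (hp : V.IsCompatibleSemilatticeTerm p) :
    ∃ Φ : Set.Ici V.eqTheory ≃o RingCon (V.semiring p hV hp),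
      ∀ (T : Set.Ici V.eqTheory) (s t : L.Term (Fin 2))
        (hs : V.ofTerm s ∈ V.semiring p hV hp) (ht : V.ofTerm t ∈ V.semiring p hV hp),
        Φ T ⟨V.ofTerm s, hs⟩ ⟨V.ofTerm t, ht⟩ ↔
          (UnivAlg.binaryTerm s, UnivAlg.binaryTerm t) ∈ T.1.carrier :=
  ⟨UnivAlg.Variety.theoryIso hV hp, fun T s t hs ht =>
    UnivAlg.Variety.congruenceOf_iff hV hp T.2 s t hs ht⟩
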